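/- Let $\lambda_1,\lambda_2,\lambda_3$ be sequences each of which consists of the normalised Fourier coefficients of a Hecke eigenform for $SL(2,\mathbb Z)$, holomorphic or Maass. That is, each $\lambda_i$ arises in one of two ways. (a) There is a holomorphic cusp form $f$ of some integral weight $k$ for $SL(2,\mathbb Z)$, an eigenfunction of all Hecke operators $T_n$, with $f(z)=\sum_{n\ge1}\lambda_i(n)\,n^{(k-1)/2}e^{2\pi i nz}$ and $\lambda_i(1)=1$. (b) There is a Maass cusp form $f$ of weight $0$ for $SL(2,\mathbb Z)$ with Laplace eigenvalue $\tfrac14+\nu^2$, an eigenfunction of all Hecke operators $T_n$ $(n\ge1)$, with $f(x+iy)=\sqrt y\sum_{n\ne0}\lambda_i(n)K_{i\nu}(2\pi|n|y)e^{2\pi i nx}$ and $\lambda_i(1)=1$. Let $V,W:\mathbb R\to\mathbb R$ be smooth functions supported on $[1,2]$, and for real $N\ge1$ and $H>0$ put $$S(N,H)=\frac1H\sum_{h\ge1}V\!\left(\frac hH\right)\sum_{n\ge1}\lambda_1(n)\lambda_2(n+h)\lambda_3(n+2h)\,W\!\left(\frac nN\right).$$ (i) For every $\varepsilon>0$ there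 is $\delta=\delta(\varepsilon)>0$, depending only on $\varepsilon$, such that for all such $\lambda_i$, $V$, $W$ and every $c>0$ there is a constant $C$ with $|S(N,H)|\le C\,N^{1-\delta}$ for all $N\ge1$ and all $H\ge c\,N^{1/2+\varepsilon}$. (ii) For all such $\lambda_i$, $V$, $W$ and every $\varepsilon>0$ there is a constant $C$ with $$|S(N,H)|\le C\left(\frac{N^{3/2+\varepsilon}}{H}+N^{1/2+\varepsilon}\right)\qquad\text{for all } N\ge1,\ H>0;$$ in particular $|S(N,H)|\le 2C\,N^{3/2+\varepsilon}/H$ if $H\le N$. -/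

import Mathlib

open scoped MatrixGroups ContDiff

noncomputable section

namespace DoubleShift

open UpperHalfPlane

/-- `∑_{b mod d} f((a z + b) / d)`. For `a, d ≥ 1` and `z` in the upper half plane every point
`(a z + b) / d` lies in the upper half plane, where `ofComplex` is the identity. -/
def heckeTranslates (f : ℍ → ℂ) (a d : ℕ) (z : ℍ) : ℂ :=
  ∑ b ∈ Finset.range d, f (ofComplex (((a : ℂ) * (z : ℂ) + (b : ℂ)) / (d : ℂ)))

/-- The `n`-th Hecke operator of level one in weight `k`:
`(T_n f)(z) = n ^ (k - 1) * ∑_{a d = n} d ^ (-k) ∑_{b mod d} f((a z + b) / d)`. -/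
def heckeHol (k : ℤ) (n : ℕ) (f : ℍ → ℂ) (z : ℍ) : ℂ :=
  (n : ℂ) ^ (k - 1) *
    ∑ p ∈ n.divisorsAntidiagonal, (p.2 : ℂ) ^ (-k) * heckeTranslates f p.1 p.2 z

/-- The `n`-th Hecke operator of level one on functions of weight zero, normalised as for Maass
forms: `(T_n f)(z) = n ^ (-1/2) * ∑_{a d = n} ∑_{b mod d} f((a z + b) / d)`. -/
def heckeMaass (n : ℕ) (f : ℍ → ℂ) (z : ℍ) : ℂ :=
  ((Real.sqrt (n : ℝ) : ℝ) : ℂ)⁻¹ *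
    ∑ p ∈ n.divisorsAntidiagonal, heckeTranslates f p.1 p.2 z

/-- The K-Bessel function `K_s(y) = ∫_0^∞ exp (-y cosh t) cosh (s t) dt`, for `y > 0`. -/
def besselK (s : ℂ) (y : ℝ) : ℂ :=
  ∫ t in Set.Ioi (0 : ℝ), ((Real.exp (-(y * Real.cosh t)) : ℝ) : ℂ) * Complex.cosh (s * (t : ℂ))

/-- `lam` is the sequence of normalised Fourier coefficients of a holomorphic Hecke cusp form `f`
for `SL(2, ℤ)`: `f(z) = ∑_{n ≥ 1} lam(n) n ^ ((k - 1) / 2) e(n z)` with `lam(1) = 1`. -/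
def IsHolomorphicHeckeCoeff (lam : ℕ → ℂ) : Prop :=
  ∃ (k : ℤ) (f : CuspForm 𝒮ℒ k),
    (∀ n : ℕ, 1 ≤ n → ∃ μ : ℂ, ∀ z : ℍ, heckeHol k n f z = μ * f z) ∧
    (∀ n : ℕ, 1 ≤ n →
      (qExpansion 1 f).coeff n = lam n * (((n : ℝ) ^ (((k : ℝ) - 1) / 2) : ℝ) : ℂ)) ∧
    lam 1 = 1

/-- `f` is a Maass cusp form (weight zero) for `SL(2, ℤ)` with Laplace eigenvalue `1/4 + ν ^ 2`.
Here `Δ` is the Euclidean Laplacian `∂²/∂x² + ∂²/∂y²`, so that `-y ^ 2 Δ` is the hyperbolic one. -/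
structure IsMaassCuspForm (ν : ℂ) (f : ℍ → ℂ) : Prop where
  smooth : ContDiffOn ℝ ∞ (fun w : ℂ => f (ofComplex w)) {w : ℂ | 0 < w.im}
  invariant : ∀ (γ : SL(2, ℤ)) (z : ℍ), f (γ • z) = f z
  eigen : ∀ z : ℍ,
    -((z.im : ℂ) ^ 2) * Laplacian.laplacian (fun w : ℂ => f (ofComplex w)) (z : ℂ) =
      (1 / 4 + ν ^ 2) * f z
  moderate : ∃ A B : ℝ, ∀ z : ℍ, 1 ≤ z.im → ‖f z‖ ≤ B * z.im ^ A
  cuspidal : ∀ y : ℝ, 0 < y →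
    ∫ x in (0 : ℝ)..1, f (ofComplex ((x : ℂ) + (y : ℂ) * Complex.I)) = 0

/-- `lam` is the sequence of normalised Fourier coefficients (at the positive integers) of a Maass
cusp form `f` for `SL(2, ℤ)` that is an eigenfunction of all Hecke operators:
`f(x + i y) = √y ∑_{n ≠ 0} c(n) K_{iν}(2 π |n| y) e(n x)` with `c(1) = 1` and `lam(n) = c(n)`. -/
def IsMaassHeckeCoeff (lam : ℕ → ℂ) : Prop :=
  ∃ (ν : ℂ) (f : ℍ → ℂ) (c : ℤ → ℂ),
    IsMaassCuspForm ν f ∧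
    (∀ n : ℕ, 1 ≤ n → ∃ μ : ℂ, ∀ z : ℍ, heckeMaass n f z = μ * f z) ∧
    (∀ z : ℍ, HasSum
      (fun n : {n : ℤ // n ≠ 0} =>
        ((Real.sqrt z.im : ℝ) : ℂ) * c n *
          besselK (Complex.I * ν) (2 * Real.pi * |((n : ℤ) : ℝ)| * z.im) *
          Complex.exp (2 * Real.pi * Complex.I * ((n : ℤ) : ℂ) * (z.re : ℂ)))
      (f z)) ∧
    c 1 = 1 ∧
    (∀ n : ℕ, 1 ≤ n → lam n = c n)

/-- Normalised Fourier coefficients of a Hecke eigenform for `SL(2, ℤ)`, holomorphic or Maass. -/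
def IsHeckeCoeff (lam : ℕ → ℂ) : Prop :=
  IsHolomorphicHeckeCoeff lam ∨ IsMaassHeckeCoeff lam

/-- A smooth function on the real line supported on `[1, 2]`. -/
def IsBump (V : ℝ → ℝ) : Prop :=
  ContDiff ℝ ∞ V ∧ tsupport V ⊆ Set.Icc 1 2

/-- `H⁻¹ ∑_h V(h / H) ∑_n l₁(n) l₂(n + h) l₃(n + 2 h) W(n / N)` over all positive integers
`h, n`; for `V`, `W` supported on `[1, 2]` only `h ≤ 2 H` and `n ≤ 2 N` contribute. -/
def doubleShiftSum (l₁ l₂ l₃ : ℕ → ℂ) (V W : ℝ → ℝ) (N H : ℝ) : ℂ :=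
  (1 / (H : ℂ)) * ∑ h ∈ Finset.Icc 1 ⌊2 * H⌋₊, (V ((h : ℝ) / H) : ℂ) *
    ∑ n ∈ Finset.Icc 1 ⌊2 * N⌋₊,
      l₁ n * l₂ (n + h) * l₃ (n + 2 * h) * (W ((n : ℝ) / N) : ℂ)

end DoubleShift

end

/-!
A cusp form is bounded on every horocycle, uniformly in the height `y` after its usual
normalisation, and on the horocycle its Fourier coefficients are `√y λ(n) Φ(n y)` with `Φ` a
Whittaker function. At height `y ≈ 1 / N` this gives two estimates: Bessel's inequality yields
`∑_{n ≤ N} |λ(n)|² ≪ N`, and convolving the form with the exponential sum of the smooth weight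
`W / Φ`, whose `L¹` norm on the circle is bounded, yields Wilton's bound
`∑ λ(n) W(n / N) e(n t) ≪ √N` uniformly in `t`.

The sum over the progressions `n, n + h, n + 2h` is the double integral over `(t, u)` of
`P(t) Q(u) X(-t - u) Y(-t - 2u)`, where `X`, `P`, `Q` are the exponential sums of `λ₁ W`, `λ₂`, `λ₃`
and `Y` is that of the weight in `h`. Taking `X` in `L^∞` (Wilton), `P` and `Q` in `L²`
(Cauchy-Schwarz and Parseval) and `Y` in `L¹` bounds it by `√N · (N + H) · 1`.

For Maass forms `Φ(u) = √A K_s(2π A u)`. The asymptotics `√y e^y K_s(y) → √(π / 2)` show that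
`K_s` does not vanish far out, so that a large `A` makes `Φ` nonzero on `[1, 2]`, and that the
Fourier-Bessel expansion is bounded at the cusp.
-/

open MeasureTheory AddCircle UpperHalfPlane Function

noncomputable section

namespace DoubleShift

/-! ### Exponential sums on the circle -/

lemma integrable_of_continuous {X E : Type*} [TopologicalSpace X] [CompactSpace X]
    [MeasurableSpace X] [OpensMeasurableSpace X] [NormedAddCommGroup E] {μ : Measure X}
    [IsFiniteMeasureOnCompacts μ] {f : X → E} (hf : Continuous f) : Integrable f μ :=
  hf.integrable_of_hasCompactSupport (.of_compactSpace f)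

lemma integral_mul_le_sqrt_mul_sqrt {X : Type*} [TopologicalSpace X] [CompactSpace X]
    [MeasurableSpace X] [OpensMeasurableSpace X] {μ : Measure X} [IsFiniteMeasureOnCompacts μ]
    {f g : X → ℝ} (hf : Continuous f) (hg : Continuous g) (hf0 : ∀ x, 0 ≤ f x)
    (hg0 : ∀ x, 0 ≤ g x) :
    ∫ x, f x * g x ∂μ ≤ √(∫ x, f x ^ 2 ∂μ) * √(∫ x, g x ^ 2 ∂μ) := by
  have memLp {u : X → ℝ} (hu : Continuous u) : MemLp u (ENNReal.ofReal 2) μ :=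
    hu.memLp_of_hasCompactSupport (.of_compactSpace u)
  simpa only [Real.rpow_ofNat, ← Real.sqrt_eq_rpow] using
    integral_mul_le_Lp_mul_Lq_of_nonneg Real.HolderConjugate.two_two (.of_forall hf0)
      (.of_forall hg0) (memLp hf) (memLp hg)

/-- The exponential sum `∑ n ∈ s, a n e(n t)` as a function on the circle `ℝ / ℤ`. -/
def expSum (s : Finset ℕ) (a : ℕ → ℂ) : C(UnitAddCircle, ℂ) :=
  ∑ n ∈ s, a n • fourier (n : ℤ)

lemma expSum_apply (s : Finset ℕ) (a : ℕ → ℂ) (t : UnitAddCircle) :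
    expSum s a t = ∑ n ∈ s, a n * fourier n t := by
  simp [expSum]

lemma fourierCoeff_expSum (s : Finset ℕ) (a : ℕ → ℂ) (m : ℤ) :
    fourierCoeff (expSum s a) m = ∑ n ∈ s, if m = n then a n else 0 := by
  have h : (expSum s a : UnitAddCircle → ℂ) = ∑ n ∈ s, a n • ⇑(fourier (n : ℤ)) := by
    ext t; simp [expSum_apply]
  rw [h, fourierCoeff.sum _ _ fun n _ => integrable_of_continuous (by fun_prop), Finset.sum_apply]
  exact Finset.sum_congr rfl fun n _ => by
    simp [fourierCoeff.const_smul, fourierCoeff_fourier, Pi.single_apply]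

lemma fourierCoeff_expSum_of_mem {s : Finset ℕ} {n : ℕ} (hn : n ∈ s) (a : ℕ → ℂ) :
    fourierCoeff (expSum s a) n = a n := by
  simp [fourierCoeff_expSum, hn]

lemma hasSum_norm_sq_fourierCoeff (F : C(UnitAddCircle, ℂ)) :
    HasSum (fun n => ‖fourierCoeff F n‖ ^ 2) (∫ t, ‖F t‖ ^ 2 ∂haarAddCircle) := by
  have h := hasSum_sq_fourierCoeff (ContinuousMap.toLp 2 haarAddCircle ℂ F)
  simp only [fourierCoeff_toLp] at h
  convert h using 1
  exact (integral_congr_ae ((ContinuousMap.coeFn_toLp haarAddCircle F).fun_comp (‖·‖ ^ 2))).symm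

lemma sum_norm_sq_fourierCoeff_le (F : C(UnitAddCircle, ℂ)) (s : Finset ℕ) :
    ∑ n ∈ s, ‖fourierCoeff F n‖ ^ 2 ≤ ‖F‖ ^ 2 := calc
  ∑ n ∈ s, ‖fourierCoeff F n‖ ^ 2
      = ∑ n ∈ s.map Nat.castEmbedding, ‖fourierCoeff F n‖ ^ 2 := by simp
  _ ≤ ∫ t, ‖F t‖ ^ 2 ∂haarAddCircle :=
    sum_le_hasSum _ (fun _ _ => by positivity) (hasSum_norm_sq_fourierCoeff F)
  _ ≤ ∫ _ : UnitAddCircle, ‖F‖ ^ 2 ∂haarAddCircle :=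
    integral_mono (integrable_of_continuous (by fun_prop)) (integrable_const _) fun t =>
      pow_le_pow_left₀ (norm_nonneg _) (F.norm_coe_le_norm t) 2
  _ = ‖F‖ ^ 2 := by simp

lemma integral_norm_sq_expSum (s : Finset ℕ) (a : ℕ → ℂ) :
    ∫ t, ‖expSum s a t‖ ^ 2 ∂haarAddCircle = ∑ n ∈ s, ‖a n‖ ^ 2 := by
  have h0 : ∀ m ∉ s.map Nat.castEmbedding, ‖fourierCoeff (expSum s a) m‖ ^ 2 = 0 := by
    intro m hm
    rw [fourierCoeff_expSum, Finset.sum_eq_zero, norm_zero, zero_pow two_ne_zero]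
    exact fun n hn => if_neg fun h => hm (by simp [h, hn])
  rw [(hasSum_norm_sq_fourierCoeff _).unique (hasSum_sum_of_ne_finset_zero h0), Finset.sum_map]
  exact Finset.sum_congr rfl fun n hn => by
    rw [Nat.castEmbedding_apply, fourierCoeff_expSum_of_mem hn]

lemma expSum_fourierCoeff_mul (s : Finset ℕ) (F : C(UnitAddCircle, ℂ)) (a : ℕ → ℂ)
    (α : UnitAddCircle) :
    expSum s (fun n => fourierCoeff F n * a n) α =
      ∫ t, F t * expSum s a (α - t) ∂haarAddCircle := by
  simp_rw [expSum_apply, Finset.mul_sum]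
  rw [integral_finsetSum _ fun n _ => integrable_of_continuous (by fun_prop)]
  refine Finset.sum_congr rfl fun n _ => ?_
  rw [fourierCoeff, mul_assoc, ← integral_mul_const]
  congr with t
  have hfourier : fourier (n : ℤ) (α - t) = fourier (-(n : ℤ)) t * fourier n α := by
    simp only [fourier_apply, ← Circle.coe_mul, ← toCircle_add]
    congr 2
    module
  rw [smul_eq_mul, hfourier]
  ring

lemma norm_expSum_fourierCoeff_mul_le (s : Finset ℕ) (F : C(UnitAddCircle, ℂ)) (a : ℕ → ℂ)
    (α : UnitAddCircle) :
    ‖expSum s (fun n => fourierCoeff F n * a n) α‖ ≤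
      ‖F‖ * ∫ t, ‖expSum s a t‖ ∂haarAddCircle := by
  rw [expSum_fourierCoeff_mul, ← integral_sub_left_eq_self (fun t => ‖expSum s a t‖) _ α,
    ← integral_const_mul]
  refine norm_integral_le_of_norm_le (integrable_of_continuous (by fun_prop))
    (.of_forall fun t => ?_)
  rw [norm_mul]
  gcongr
  exact F.norm_coe_le_norm t

lemma four_mul_abs_le_norm_one_sub_fourier {x : ℝ} (hx : |x| ≤ 1 / 2) :
    4 * |x| ≤ ‖1 - fourier 1 (x : UnitAddCircle)‖ := by
  have h := Real.mul_abs_le_abs_sin (x := Real.pi * x) (by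
    rw [abs_mul, abs_of_pos Real.pi_pos]; nlinarith [Real.pi_pos])
  rw [abs_mul, abs_of_pos Real.pi_pos] at h
  have hnorm : ‖1 - fourier 1 (x : UnitAddCircle)‖ = 2 * |Real.sin (Real.pi * x)| := by
    have h := Complex.norm_exp_I_mul_ofReal_sub_one (2 * (Real.pi * x))
    rw [mul_div_cancel_left₀ _ two_ne_zero, norm_mul, Real.norm_ofNat, Real.norm_eq_abs] at h
    rw [norm_sub_rev, fourier_coe_apply, ← h]
    push_cast
    ring_nf
  calc 4 * |x| = 2 * (2 / Real.pi * (Real.pi * |x|)) := by field_simp; ring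
    _ ≤ _ := by rw [hnorm]; gcongr

lemma integral_inv_one_add_sq_le {N : ℝ} (hN : 0 < N) :
    ∫ t : UnitAddCircle, (1 + (N * ‖1 - fourier 1 t‖) ^ 2)⁻¹ ∂haarAddCircle ≤ N⁻¹ := by
  rw [integral_haarAddCircle, inv_one, one_smul,
    ← UnitAddCircle.intervalIntegral_preimage (-1 / 2)]
  have hcont : Continuous fun x : ℝ => (1 + ((4 * N) * x) ^ 2)⁻¹ :=
    Continuous.inv₀ (by fun_prop) fun x => by positivity
  have hcont' : Continuous fun x : ℝ =>
      (1 + (N * ‖1 - fourier 1 (x : UnitAddCircle)‖) ^ 2)⁻¹ :=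
    Continuous.inv₀ (by fun_prop) fun x => by positivity
  calc _ ≤ ∫ x in (-1 / 2 : ℝ)..-1 / 2 + 1, (1 + ((4 * N) * x) ^ 2)⁻¹ := by
        refine intervalIntegral.integral_mono_on (by norm_num) (hcont'.intervalIntegrable _ _)
          (hcont.intervalIntegrable _ _) fun x hx => ?_
        have := four_mul_abs_le_norm_one_sub_fourier (x := x)
          (abs_le.mpr ⟨by linarith [hx.1], by linarith [hx.2]⟩)
        rw [← sq_abs (4 * N * x), abs_mul, abs_of_pos (by positivity : 0 < 4 * N), mul_comm 4 N,
          mul_assoc]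
        gcongr
    _ = (4 * N)⁻¹ * (Real.arctan (2 * N) - Real.arctan (-(2 * N))) := by
        rw [intervalIntegral.integral_comp_mul_left (fun x => (1 + x ^ 2)⁻¹) (by positivity),
          integral_inv_one_add_sq, smul_eq_mul]
        ring_nf
    _ ≤ (4 * N)⁻¹ * 4 := by
        gcongr
        linarith [Real.arctan_lt_pi_div_two (2 * N), Real.neg_pi_div_two_lt_arctan (-(2 * N)),
          Real.pi_le_four]
    _ = N⁻¹ := by field_simp

lemma integral_norm_le_of_integral_norm_sq (F : C(UnitAddCircle, ℂ)) {N : ℝ} (hN : 0 < N) :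
    ∫ t, ‖F t‖ ∂haarAddCircle ≤ (N⁻¹ * ∫ t, ‖F t‖ ^ 2 ∂haarAddCircle +
      N * ∫ t, ‖(1 - fourier 1 t) * F t‖ ^ 2 ∂haarAddCircle + 1) / 2 := by
  -- AM-GM against the weight `N / w`, whose integral is at most `1`.
  set w : UnitAddCircle → ℝ := fun t => 1 + (N * ‖1 - fourier 1 t‖) ^ 2 with hw
  have hw_inv : Continuous fun t => (w t)⁻¹ :=
    Continuous.inv₀ (by fun_prop) fun t => by positivity
  have hpoint (t : UnitAddCircle) : ‖F t‖ ≤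
      (N⁻¹ * ‖F t‖ ^ 2 + N * ‖(1 - fourier 1 t) * F t‖ ^ 2 + N * (w t)⁻¹) / 2 := by
    have hw0 : 0 < w t := by positivity
    have hsq : N⁻¹ * ‖F t‖ ^ 2 + N * ‖(1 - fourier 1 t) * F t‖ ^ 2 =
        N⁻¹ * w t * ‖F t‖ ^ 2 := by
      rw [norm_mul, hw]; field_simp
    have hamgm : 0 ≤ N⁻¹ * w t * (‖F t‖ - N * (w t)⁻¹) ^ 2 := by positivity
    have hexpand : N⁻¹ * w t * (‖F t‖ - N * (w t)⁻¹) ^ 2 =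
        N⁻¹ * w t * ‖F t‖ ^ 2 + N * (w t)⁻¹ - 2 * ‖F t‖ := by field_simp; ring
    linarith
  have hint₁ : Integrable (fun t => N⁻¹ * ‖F t‖ ^ 2) haarAddCircle :=
    integrable_of_continuous (by fun_prop)
  have hint₂ : Integrable (fun t => N * ‖(1 - fourier 1 t) * F t‖ ^ 2) haarAddCircle :=
    integrable_of_continuous (by fun_prop)
  have hint₃ : Integrable (fun t => N * (w t)⁻¹) haarAddCircle :=
    integrable_of_continuous (by fun_prop)
  refine (integral_mono (integrable_of_continuous (by fun_prop))
    (((hint₁.add hint₂).add hint₃).div_const 2) hpoint).trans ?_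
  rw [integral_div, integral_add' (hint₁.add hint₂) hint₃, integral_add' hint₁ hint₂,
    integral_const_mul, integral_const_mul, integral_const_mul]
  have h := mul_le_mul_of_nonneg_left (integral_inv_one_add_sq_le hN) hN.le
  rw [mul_inv_cancel₀ hN.ne'] at h
  gcongr

lemma one_sub_fourier_mul_expSum {g : ℕ → ℂ} (h0 : g 0 = 0) (M : ℕ) (t : UnitAddCircle) :
    (1 - fourier 1 t) * expSum (Finset.Icc 1 M) g t =
      expSum (Finset.Icc 1 M) (fun n => g n - g (n - 1)) t - g M * fourier (M + 1) t := by
  simp only [expSum_apply]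
  induction M with
  | zero => simp [h0]
  | succ M ih =>
    rw [Finset.sum_Icc_succ_top (by omega), Finset.sum_Icc_succ_top (by omega), mul_add, ih]
    simp only [Nat.cast_add, Nat.cast_one, fourier_add, add_tsub_cancel_right]
    ring

lemma integral_norm_expSum_le_of_sum_norm_sq {g : ℕ → ℂ} {M : ℕ} (h0 : g 0 = 0)
    (hM : g (M + 1) = 0) {N : ℝ} (hN : 0 < N) :
    ∫ t, ‖expSum (Finset.Icc 1 M) g t‖ ∂haarAddCircle ≤
      (N⁻¹ * ∑ n ∈ Finset.Icc 1 M, ‖g n‖ ^ 2 +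
        N * ∑ n ∈ Finset.Icc 1 (M + 1), ‖g n - g (n - 1)‖ ^ 2 + 1) / 2 := by
  have hdiff (t : UnitAddCircle) : (1 - fourier 1 t) * expSum (Finset.Icc 1 M) g t =
      expSum (Finset.Icc 1 (M + 1)) (fun n => g n - g (n - 1)) t := by
    have h := one_sub_fourier_mul_expSum h0 (M + 1) t
    rw [hM, zero_mul, sub_zero] at h
    rw [← h]
    simp [expSum_apply, Finset.sum_Icc_succ_top, hM]
  simpa only [hdiff, integral_norm_sq_expSum] using
    integral_norm_le_of_integral_norm_sq (expSum (Finset.Icc 1 M) g) hN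

/-! ### Smooth weights -/

/-- Lipschitz weights supported in `(1, 2)`: what is used of the smooth weights `V` and `W`, and
of their quotients by Whittaker functions. -/
def IsLipschitzBump {E : Type*} [NormedAddCommGroup E] (G : ℝ → E) : Prop :=
  (∃ K, LipschitzWith K G) ∧ Function.support G ⊆ Set.Ioo 1 2

lemma IsBump.isLipschitzBump {V : ℝ → ℝ} (h : IsBump V) : IsLipschitzBump V := by
  have hc : HasCompactSupport V := isCompact_Icc.of_isClosed_subset (isClosed_tsupport V) h.2
  refine ⟨h.1.lipschitzWith_of_hasCompactSupport hc (by simp), ?_⟩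
  rw [← interior_Icc]
  exact interior_maximal ((subset_tsupport V).trans h.2) h.1.continuous.isOpen_support

namespace IsLipschitzBump

lemma ofReal {V : ℝ → ℝ} (h : IsLipschitzBump V) : IsLipschitzBump fun u => (V u : ℂ) := by
  obtain ⟨⟨K, hK⟩, hsupp⟩ := h
  exact ⟨⟨1 * K, Complex.isometry_ofReal.lipschitz.comp hK⟩,
    fun u hu => hsupp (by simpa using hu)⟩

variable {E : Type*} [NormedAddCommGroup E] {G : ℝ → E}

lemma eq_zero (h : IsLipschitzBump G) {u : ℝ} (hu : u ∉ Set.Ioo 1 2) : G u = 0 :=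
  Function.notMem_support.mp fun hu' => hu (h.2 hu')

lemma norm_le (h : IsLipschitzBump G) {K : NNReal} (hK : LipschitzWith K G) (u : ℝ) :
    ‖G u‖ ≤ K := by
  by_cases hu : u ∈ Set.Ioo 1 2
  · have hle := hK.norm_sub_le u 1
    rw [h.eq_zero (u := 1) (by simp), sub_zero, Real.norm_of_nonneg (by linarith [hu.1])] at hle
    nlinarith [hu.2, K.coe_nonneg]
  · simp [h.eq_zero hu]

end IsLipschitzBump

lemma IsLipschitzBump.integral_norm_expSum_le {G : ℝ → ℂ} (hG : IsLipschitzBump G) :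
    ∃ D : ℝ, ∀ N : ℝ, 1 / 2 ≤ N →
      ∫ t, ‖expSum (Finset.Icc 1 ⌊2 * N⌋₊) (fun n => G (n / N)) t‖ ∂haarAddCircle ≤ D := by
  obtain ⟨K, hK⟩ := hG.1
  refine ⟨(2 * K ^ 2 + 4 * K ^ 2 + 1) / 2, fun N hN => ?_⟩
  have hN0 : 0 < N := by linarith
  set M := ⌊2 * N⌋₊
  have hMN : (M : ℝ) ≤ 2 * N := Nat.floor_le (by positivity)
  have hG0 : G ((0 : ℕ) / N) = 0 := hG.eq_zero (by simp)
  have hGM : G ((M + 1 : ℕ) / N) = 0 := hG.eq_zero fun h => by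
    have hlt := Nat.lt_floor_add_one (2 * N)
    have hle := (div_lt_iff₀ hN0).mp h.2
    push_cast at hle
    linarith
  have hsize : ∑ n ∈ Finset.Icc 1 M, ‖G (n / N)‖ ^ 2 ≤ 2 * N * K ^ 2 := calc
    _ ≤ ∑ n ∈ Finset.Icc 1 M, (K : ℝ) ^ 2 := by
      gcongr with n
      exact hG.norm_le hK _
    _ ≤ _ := by
      rw [Finset.sum_const, Nat.card_Icc, nsmul_eq_mul, Nat.add_sub_cancel]
      gcongr
  have hvar : ∑ n ∈ Finset.Icc 1 (M + 1), ‖G (n / N) - G ((n - 1 : ℕ) / N)‖ ^ 2 ≤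
      4 * N * (K / N) ^ 2 := calc
    _ ≤ ∑ n ∈ Finset.Icc 1 (M + 1), (K / N : ℝ) ^ 2 := by
      gcongr with n hn
      refine (hK.norm_sub_le _ _).trans_eq ?_
      rw [Nat.cast_pred (Finset.mem_Icc.mp hn).1, ← sub_div, sub_sub_cancel,
        Real.norm_of_nonneg (by positivity), mul_one_div]
    _ ≤ _ := by
      rw [Finset.sum_const, Nat.card_Icc, nsmul_eq_mul, Nat.add_sub_cancel]
      push_cast
      gcongr
      linarith
  calc _ ≤ _ := integral_norm_expSum_le_of_sum_norm_sq hG0 hGM hN0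
    _ ≤ (N⁻¹ * (2 * N * K ^ 2) + N * (4 * N * (K / N) ^ 2) + 1) / 2 := by gcongr
    _ = _ := by field_simp

lemma lipschitzWith_of_lipschitzOnWith_Icc {E : Type*} [NormedAddCommGroup E] {f : ℝ → E}
    {a b : ℝ} (hab : a ≤ b) {K : NNReal} (hf : LipschitzOnWith K f (Set.Icc a b))
    (h0 : ∀ x ∉ Set.Ioo a b, f x = 0) : LipschitzWith K f := by
  have hproj : f = (Set.Icc a b).domRestrict f ∘ Set.projIcc a b hab := by
    ext x
    rcases le_total x a with hx | hx
    · simp [Set.projIcc_of_le_left hab hx, h0 x fun h => hx.not_gt h.1, h0 a (by simp)]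
    rcases le_total b x with hx' | hx'
    · simp [Set.projIcc_of_right_le hab hx', h0 x fun h => hx'.not_gt h.2, h0 b (by simp)]
    · simp [Set.projIcc_of_mem hab ⟨hx, hx'⟩]
  rw [hproj, ← mul_one K]
  exact hf.to_restrict.comp (LipschitzWith.projIcc hab)

lemma exists_pos_forall_le_norm {E : Type*} [NormedAddCommGroup E] {Φ : ℝ → E} {a b : ℝ}
    (hab : a ≤ b) (hΦ : ContinuousOn Φ (Set.Icc a b)) (hne : ∀ u ∈ Set.Icc a b, Φ u ≠ 0) :
    ∃ m, 0 < m ∧ ∀ u ∈ Set.Icc a b, m ≤ ‖Φ u‖ := by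
  obtain ⟨v, hv, hmin⟩ := isCompact_Icc.exists_isMinOn (Set.nonempty_Icc.mpr hab) hΦ.norm
  exact ⟨‖Φ v‖, norm_pos_iff.mpr (hne v hv), fun u hu => hmin hu⟩

lemma IsLipschitzBump.div {G Φ : ℝ → ℂ} (hG : IsLipschitzBump G) {L : NNReal}
    (hΦ : LipschitzOnWith L Φ (Set.Icc 1 2)) (hne : ∀ u ∈ Set.Icc (1 : ℝ) 2, Φ u ≠ 0) :
    IsLipschitzBump fun u => G u / Φ u := by
  obtain ⟨K, hK⟩ := hG.1
  obtain ⟨m, hm, hlow⟩ := exists_pos_forall_le_norm one_le_two hΦ.continuousOn hne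
  refine ⟨⟨(K / m + K * L / (m * m)).toNNReal, lipschitzWith_of_lipschitzOnWith_Icc one_le_two
    (LipschitzOnWith.of_dist_le_mul fun u hu v hv => ?_) fun u hu => by simp [hG.eq_zero hu]⟩,
    fun u hu => hG.2 (left_ne_zero_of_mul hu)⟩
  rw [Real.coe_toNNReal _ (by positivity), dist_eq_norm]
  have hsplit : G u / Φ u - G v / Φ v = (G u - G v) / Φ u + G v * (Φ v - Φ u) / (Φ u * Φ v) := by
    field_simp [hne u hu, hne v hv]
    ring
  calc ‖G u / Φ u - G v / Φ v‖
      ≤ ‖G u - G v‖ / ‖Φ u‖ + ‖G v‖ * ‖Φ v - Φ u‖ / (‖Φ u‖ * ‖Φ v‖) := by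
        rw [hsplit, ← norm_div, ← norm_mul, ← norm_mul, ← norm_div]
        exact norm_add_le _ _
    _ ≤ K * dist u v / m + K * (L * dist u v) / (m * m) := by
        gcongr
        · simpa only [dist_eq_norm] using hK.dist_le_mul u v
        · exact hlow u hu
        · exact hG.norm_le hK v
        · simpa only [dist_eq_norm, norm_sub_rev] using hΦ.dist_le_mul u hu v hv
        · exact hlow u hu
        · exact hlow v hv
    _ = _ := by ring

/-- At every height `y > 0` the numbers `√y l(n) Φ(n y)`, `n ≥ 1`, are Fourier coefficients of a
continuous function on the horocycle `ℝ / ℤ`, bounded independently of `y`. For the coefficients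
of a cusp form `Φ` is the Whittaker function and the function on the horocycle is the
restriction of the (suitably normalised) form. -/
def HasHorocycleModel (l : ℕ → ℂ) : Prop :=
  ∃ (Φ : ℝ → ℂ) (K : NNReal) (B : ℝ), LipschitzOnWith K Φ (Set.Icc 1 2) ∧
    (∀ u ∈ Set.Icc (1 : ℝ) 2, Φ u ≠ 0) ∧
    ∀ y : ℝ, 0 < y → ∃ F : C(UnitAddCircle, ℂ), ‖F‖ ≤ B ∧
      ∀ n : ℕ, 1 ≤ n → fourierCoeff F n = √y * l n * Φ (n * y)

lemma sum_Icc_le_of_dyadic {a : ℕ → ℝ} {C : ℝ} (hC : 0 ≤ C)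
    (h : ∀ M : ℕ, 1 ≤ M → ∑ n ∈ Finset.Ioc (M / 2) M, a n ≤ C * (M / 2)) (M : ℕ) :
    ∑ n ∈ Finset.Icc 1 M, a n ≤ C * M := by
  change ∑ n ∈ Finset.Ioc 0 M, a n ≤ C * M
  induction M using Nat.strong_induction_on with
  | _ M ih =>
    rcases Nat.eq_zero_or_pos M with rfl | hM
    · simp
    · rw [← Finset.sum_Ioc_consecutive a (Nat.zero_le (M / 2)) (by omega)]
      have hhalf : C * ((M / 2 : ℕ) : ℝ) ≤ C * (M / 2) := by gcongr; exact Nat.cast_div_le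
      linarith [ih (M / 2) (by omega), h M hM]

namespace HasHorocycleModel

lemma sum_norm_sq_le {l : ℕ → ℂ} (hl : HasHorocycleModel l) :
    ∃ C : ℝ, 0 ≤ C ∧ ∀ M : ℕ, ∑ n ∈ Finset.Icc 1 M, ‖l n‖ ^ 2 ≤ C * M := by
  obtain ⟨Φ, K, B, hΦ, hne, hF⟩ := hl
  obtain ⟨m, hm, hlow⟩ := exists_pos_forall_le_norm one_le_two hΦ.continuousOn hne
  have hC : 0 ≤ B ^ 2 / m ^ 2 := by positivity
  refine ⟨B ^ 2 / m ^ 2, hC, sum_Icc_le_of_dyadic hC fun M hM => ?_⟩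
  have hM0 : (0 : ℝ) < M := by exact_mod_cast hM
  have hy : (0 : ℝ) < 2 / M := by positivity
  obtain ⟨F, hFB, hFn⟩ := hF (2 / M) hy
  have hterm : ∀ n ∈ Finset.Ioc (M / 2) M, 2 / M * m ^ 2 * ‖l n‖ ^ 2 ≤ ‖fourierCoeff F n‖ ^ 2 := by
    intro n hn
    rw [Finset.mem_Ioc] at hn
    have hnM : (n : ℝ) ≤ M := by exact_mod_cast hn.2
    have hMn : (M : ℝ) ≤ n * 2 := by exact_mod_cast (by omega : M ≤ n * 2)
    have hmem : (n : ℝ) * (2 / M) ∈ Set.Icc (1 : ℝ) 2 := by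
      rw [Set.mem_Icc, mul_div_assoc', le_div_iff₀ hM0, div_le_iff₀ hM0]
      constructor <;> linarith
    rw [hFn n (by omega), norm_mul, norm_mul, mul_pow, mul_pow, Complex.norm_real,
      Real.norm_of_nonneg (Real.sqrt_nonneg _), Real.sq_sqrt hy.le, mul_right_comm]
    gcongr
    exact hlow _ hmem
  have hbessel := (Finset.sum_le_sum hterm).trans
    ((sum_norm_sq_fourierCoeff_le F _).trans (pow_le_pow_left₀ (norm_nonneg _) hFB 2))
  rw [← Finset.mul_sum] at hbessel
  calc _ ≤ B ^ 2 / (2 / M * m ^ 2) := by rwa [le_div_iff₀' (by positivity)]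
    _ = _ := by field_simp

lemma norm_expSum_le {l : ℕ → ℂ} (hl : HasHorocycleModel l) {G : ℝ → ℂ}
    (hG : IsLipschitzBump G) : ∃ C : ℝ, 0 ≤ C ∧ ∀ N : ℝ, 1 / 2 ≤ N → ∀ t : UnitAddCircle,
      ‖expSum (Finset.Icc 1 ⌊2 * N⌋₊) (fun n => l n * G (n / N)) t‖ ≤ C * √N := by
  obtain ⟨Φ, K, B, hΦ, hne, hF⟩ := hl
  obtain ⟨D, hD⟩ := (hG.div hΦ hne).integral_norm_expSum_le
  have hB : 0 ≤ B := by
    obtain ⟨F, hFB, -⟩ := hF 1 one_pos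
    exact (norm_nonneg F).trans hFB
  have hD0 : 0 ≤ D := (integral_nonneg fun _ => norm_nonneg _).trans (hD 1 (by norm_num))
  refine ⟨B * D, by positivity, fun N hN t => ?_⟩
  have hN0 : 0 < N := by linarith
  obtain ⟨F, hFB, hFn⟩ := hF N⁻¹ (by positivity)
  set s := Finset.Icc 1 ⌊2 * N⌋₊
  have hcoeff : ∀ n ∈ s, l n * G (n / N) =
      √N * (fourierCoeff F n * (G (n / N) / Φ (n / N))) := by
    intro n hn
    have hsqrt : (√N : ℂ) ≠ 0 := by exact_mod_cast (Real.sqrt_pos.mpr hN0).ne'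
    by_cases hmem : (n : ℝ) / N ∈ Set.Ioo (1 : ℝ) 2
    · have := hne _ (Set.Ioo_subset_Icc_self hmem)
      rw [hFn n (Finset.mem_Icc.mp hn).1, ← div_eq_mul_inv, Real.sqrt_inv, Complex.ofReal_inv]
      field_simp
    · simp [hG.eq_zero hmem]
  have hsum : expSum s (fun n => l n * G (n / N)) t =
      √N * expSum s (fun n => fourierCoeff F n * (G (n / N) / Φ (n / N))) t := by
    simp only [expSum_apply, Finset.mul_sum]
    exact Finset.sum_congr rfl fun n hn => by rw [hcoeff n hn, mul_assoc]
  rw [hsum, norm_mul, Complex.norm_real, Real.norm_of_nonneg (Real.sqrt_nonneg _), mul_comm]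
  gcongr
  exact (norm_expSum_fourierCoeff_mul_le s F _ t).trans
    (mul_le_mul hFB (hD N hN) (integral_nonneg fun _ => norm_nonneg _) hB)

end HasHorocycleModel

/-! ### Sums over three-term progressions -/

lemma sum_progression_eq_integral (I J s : Finset ℕ) (v x p q : ℕ → ℂ)
    (hs : ∀ h ∈ I, ∀ n ∈ J, n + h ∈ s ∧ n + 2 * h ∈ s) :
    ∑ h ∈ I, v h * ∑ n ∈ J, x n * p (n + h) * q (n + 2 * h) =
      ∫ z : UnitAddCircle × UnitAddCircle, expSum s p z.1 * expSum s q z.2 *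
        expSum J x (-z.1 - z.2) * expSum I v (-z.1 - (2 : ℤ) • z.2)
        ∂haarAddCircle.prod haarAddCircle := by
  have hterm (z : UnitAddCircle × UnitAddCircle) :
      expSum s p z.1 * expSum s q z.2 *
        expSum J x (-z.1 - z.2) * expSum I v (-z.1 - (2 : ℤ) • z.2) =
      ∑ h ∈ I, ∑ n ∈ J, v h * x n * ((fourier (-((n + h : ℕ) : ℤ)) z.1 • expSum s p z.1) *
        (fourier (-((n + 2 * h : ℕ) : ℤ)) z.2 • expSum s q z.2)) := by
    rw [expSum_apply J, expSum_apply I, mul_assoc, mul_comm (∑ n ∈ J, _), Finset.sum_mul_sum,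
      Finset.mul_sum]
    refine Finset.sum_congr rfl fun h _ => ?_
    rw [Finset.mul_sum]
    refine Finset.sum_congr rfl fun n _ => ?_
    have hchar : fourier (n : ℤ) (-z.1 - z.2) * fourier (h : ℤ) (-z.1 - (2 : ℤ) • z.2) =
        fourier (-((n + h : ℕ) : ℤ)) z.1 * fourier (-((n + 2 * h : ℕ) : ℤ)) z.2 := by
      simp only [fourier_apply, ← Circle.coe_mul, ← toCircle_add]
      congr 2
      push_cast
      module
    simp only [smul_eq_mul]
    linear_combination (v h * x n * expSum s p z.1 * expSum s q z.2) * hchar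
  simp_rw [hterm]
  rw [integral_finsetSum _ fun h _ => integrable_of_continuous (by fun_prop)]
  refine Finset.sum_congr rfl fun h hh => ?_
  rw [integral_finsetSum _ fun n _ => integrable_of_continuous (by fun_prop), Finset.mul_sum]
  refine Finset.sum_congr rfl fun n hn => ?_
  rw [integral_const_mul, integral_prod_mul (fun t => fourier (-((n + h : ℕ) : ℤ)) t • expSum s p t)
    (fun t => fourier (-((n + 2 * h : ℕ) : ℤ)) t • expSum s q t)]
  change _ = v h * x n * (fourierCoeff (expSum s p) _ * fourierCoeff (expSum s q) _)
  rw [fourierCoeff_expSum_of_mem (hs h hh n hn).1, fourierCoeff_expSum_of_mem (hs h hh n hn).2]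
  ring

lemma integral_comp_sub_two_zsmul (s : UnitAddCircle) {f : UnitAddCircle → ℝ}
    (hf : Continuous f) :
    ∫ t, f (s - (2 : ℤ) • t) ∂haarAddCircle = ∫ t, f t ∂haarAddCircle := by
  have h := Measure.measurePreserving_zsmul (haarAddCircle (T := 1)) two_ne_zero
  rw [← integral_sub_left_eq_self f haarAddCircle s]
  conv_rhs => rw [← h.map_eq]
  exact (integral_map (f := fun u => f (s - u)) h.aemeasurable
    (Continuous.aestronglyMeasurable (by fun_prop))).symm

lemma integral_mul_mul_comp_le {p q v : UnitAddCircle → ℝ} (hp : Continuous p)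
    (hq : Continuous q) (hv : Continuous v) (hp0 : ∀ t, 0 ≤ p t) (hq0 : ∀ t, 0 ≤ q t)
    (hv0 : ∀ t, 0 ≤ v t) :
    ∫ z : UnitAddCircle × UnitAddCircle, p z.1 * q z.2 * v (-z.1 - (2 : ℤ) • z.2)
        ∂haarAddCircle.prod haarAddCircle ≤
      √(∫ t, p t ^ 2 ∂haarAddCircle) * √(∫ t, q t ^ 2 ∂haarAddCircle) *
        ∫ t, v t ∂haarAddCircle := by
  have htranslate (u : UnitAddCircle) :
      ∫ t, p t * q u * v (-t - (2 : ℤ) • u) ∂haarAddCircle =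
        ∫ s, v s * (p (-s - (2 : ℤ) • u) * q u) ∂haarAddCircle := by
    rw [← integral_sub_left_eq_self _ haarAddCircle (-((2 : ℤ) • u))]
    refine integral_congr_ae (.of_forall fun s => ?_)
    simp only [neg_sub', neg_neg, sub_neg_eq_add, add_sub_cancel_left]
    rw [show -((2 : ℤ) • u) - s = -s - (2 : ℤ) • u by abel]
    ring
  have hinner (s : UnitAddCircle) : ∫ u, p (-s - (2 : ℤ) • u) * q u ∂haarAddCircle ≤
      √(∫ t, p t ^ 2 ∂haarAddCircle) * √(∫ t, q t ^ 2 ∂haarAddCircle) := by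
    rw [← integral_comp_sub_two_zsmul (-s) (f := fun t => p t ^ 2) (by fun_prop)]
    exact integral_mul_le_sqrt_mul_sqrt (by fun_prop) hq (fun _ => hp0 _) hq0
  have hint : Integrable (fun z : UnitAddCircle × UnitAddCircle =>
      v z.2 * (p (-z.2 - (2 : ℤ) • z.1) * q z.1)) (haarAddCircle.prod haarAddCircle) :=
    integrable_of_continuous (by fun_prop)
  rw [integral_prod_symm _ (integrable_of_continuous (by fun_prop))]
  simp only [htranslate]
  rw [integral_integral_swap hint, mul_comm, ← integral_mul_const]
  simp only [integral_const_mul]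
  have hnonneg (s : UnitAddCircle) :
      0 ≤ v s * ∫ u, p (-s - (2 : ℤ) • u) * q u ∂haarAddCircle :=
    mul_nonneg (hv0 s) (integral_nonneg fun u => mul_nonneg (hp0 _) (hq0 u))
  exact integral_mono_of_nonneg (.of_forall hnonneg) ((integrable_of_continuous hv).mul_const _)
    (.of_forall fun s => mul_le_mul_of_nonneg_left (hinner s) (hv0 s))

lemma norm_sum_progression_le (I J s : Finset ℕ) (v x p q : ℕ → ℂ) {A : ℝ}
    (hs : ∀ h ∈ I, ∀ n ∈ J, n + h ∈ s ∧ n + 2 * h ∈ s) (hA : ∀ t, ‖expSum J x t‖ ≤ A) :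
    ‖∑ h ∈ I, v h * ∑ n ∈ J, x n * p (n + h) * q (n + 2 * h)‖ ≤
      A * (√(∑ n ∈ s, ‖p n‖ ^ 2) * √(∑ n ∈ s, ‖q n‖ ^ 2) *
        ∫ t, ‖expSum I v t‖ ∂haarAddCircle) := by
  have hA0 : 0 ≤ A := (norm_nonneg _).trans (hA 0)
  rw [sum_progression_eq_integral I J s v x p q hs]
  calc _ ≤ ∫ z : UnitAddCircle × UnitAddCircle, A * (‖expSum s p z.1‖ * ‖expSum s q z.2‖ *
          ‖expSum I v (-z.1 - (2 : ℤ) • z.2)‖) ∂haarAddCircle.prod haarAddCircle := by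
        refine norm_integral_le_of_norm_le (integrable_of_continuous (by fun_prop))
          (.of_forall fun z => ?_)
        rw [norm_mul, norm_mul, norm_mul, mul_right_comm, mul_comm A]
        gcongr
        exact hA _
    _ ≤ _ := by
        rw [integral_const_mul, ← integral_norm_sq_expSum, ← integral_norm_sq_expSum]
        gcongr
        exact integral_mul_mul_comp_le (by fun_prop) (by fun_prop) (by fun_prop)
          (fun _ => norm_nonneg _) (fun _ => norm_nonneg _) fun _ => norm_nonneg _

lemma norm_doubleShiftSum_le (l₁ l₂ l₃ : ℕ → ℂ) (V W : ℝ → ℝ) {N H A : ℝ} (hH : 0 ≤ H)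
    (hA : ∀ t, ‖expSum (Finset.Icc 1 ⌊2 * N⌋₊) (fun n => l₁ n * (W (n / N) : ℂ)) t‖ ≤ A) :
    ‖doubleShiftSum l₁ l₂ l₃ V W N H‖ ≤ H⁻¹ * (A *
      (√(∑ n ∈ Finset.Icc 1 (⌊2 * N⌋₊ + 2 * ⌊2 * H⌋₊), ‖l₂ n‖ ^ 2) *
        √(∑ n ∈ Finset.Icc 1 (⌊2 * N⌋₊ + 2 * ⌊2 * H⌋₊), ‖l₃ n‖ ^ 2) *
        ∫ t, ‖expSum (Finset.Icc 1 ⌊2 * H⌋₊) (fun h => (V (h / H) : ℂ)) t‖ ∂haarAddCircle)) := by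
  have hmem : ∀ h ∈ Finset.Icc 1 ⌊2 * H⌋₊, ∀ n ∈ Finset.Icc 1 ⌊2 * N⌋₊,
      n + h ∈ Finset.Icc 1 (⌊2 * N⌋₊ + 2 * ⌊2 * H⌋₊) ∧
        n + 2 * h ∈ Finset.Icc 1 (⌊2 * N⌋₊ + 2 * ⌊2 * H⌋₊) := by
    intro h hh n hn
    simp only [Finset.mem_Icc] at *
    omega
  rw [doubleShiftSum, norm_mul, one_div, norm_inv, Complex.norm_real, Real.norm_of_nonneg hH]
  simp only [mul_right_comm (l₁ _ * l₂ _) _ (W _ : ℂ), mul_right_comm (l₁ _) _ (W _ : ℂ)]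
  gcongr
  exact norm_sum_progression_le _ _ _ _ _ l₂ l₃ hmem hA

lemma exists_norm_doubleShiftSum_le {l₁ l₂ l₃ : ℕ → ℂ} (h₁ : HasHorocycleModel l₁)
    (h₂ : HasHorocycleModel l₂) (h₃ : HasHorocycleModel l₃) {V W : ℝ → ℝ}
    (hV : IsLipschitzBump V) (hW : IsLipschitzBump W) :
    ∃ C : ℝ, 0 ≤ C ∧ ∀ N H : ℝ, 1 ≤ N → 0 < H →
      ‖doubleShiftSum l₁ l₂ l₃ V W N H‖ ≤ C * (N ^ (3 / 2 : ℝ) / H + N ^ (1 / 2 : ℝ)) := by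
  obtain ⟨A, hA0, hA⟩ := h₁.norm_expSum_le hW.ofReal
  obtain ⟨C₂, hC₂, h₂⟩ := h₂.sum_norm_sq_le
  obtain ⟨C₃, hC₃, h₃⟩ := h₃.sum_norm_sq_le
  obtain ⟨D, hD⟩ := hV.ofReal.integral_norm_expSum_le
  have hD0 : 0 ≤ D := (integral_nonneg fun _ => norm_nonneg _).trans (hD 1 (by norm_num))
  refine ⟨4 * A * √C₂ * √C₃ * D, by positivity, fun N H hN hH => ?_⟩
  have hN0 : 0 < N := by linarith
  rcases lt_or_ge H (1 / 2) with hH2 | hH2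
  · have hempty : ⌊2 * H⌋₊ = 0 := Nat.floor_eq_zero.mpr (by linarith)
    simp only [doubleShiftSum, hempty, Finset.Icc_eq_empty_of_lt one_pos, Finset.sum_empty,
      mul_zero, norm_zero]
    positivity
  have hL : ((⌊2 * N⌋₊ + 2 * ⌊2 * H⌋₊ : ℕ) : ℝ) ≤ 4 * (N + H) := by
    push_cast
    linarith [Nat.floor_le (by positivity : 0 ≤ 2 * N), Nat.floor_le (by positivity : 0 ≤ 2 * H)]
  have hsq : √(C₂ * (4 * (N + H))) * √(C₃ * (4 * (N + H))) = 4 * √C₂ * √C₃ * (N + H) := by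
    rw [Real.sqrt_mul hC₂, Real.sqrt_mul hC₃, mul_mul_mul_comm, Real.mul_self_sqrt (by positivity)]
    ring
  have hpow : N ^ (3 / 2 : ℝ) = √N * N := by
    rw [Real.sqrt_eq_rpow, ← Real.rpow_add_one hN0.ne']
    norm_num
  calc _ ≤ _ := norm_doubleShiftSum_le l₁ l₂ l₃ V W hH.le (hA N (by linarith))
    _ ≤ H⁻¹ * (A * √N * (√(C₂ * (4 * (N + H))) * √(C₃ * (4 * (N + H))) * D)) := by
        gcongr
        · exact (h₂ _).trans (by gcongr)
        · exact (h₃ _).trans (by gcongr)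
        · exact hD H hH2
    _ = _ := by
        rw [hsq, hpow, ← Real.sqrt_eq_rpow]
        field_simp

/-! ### Holomorphic cusp forms -/

lemma exists_continuousMap_horocycle {f : ℍ → ℂ} (hf : Continuous f)
    (hper : Periodic (f ∘ ofComplex) 1) {y B : ℝ} (hy : 0 < y)
    (hB : ∀ z : ℍ, z.im = y → ‖f z‖ ≤ B) :
    ∃ F : C(UnitAddCircle, ℂ), ‖F‖ ≤ B ∧ ∀ x : ℝ, F x = f (ofComplex (x + y * Complex.I)) := by
  have hpos (x : ℝ) : 0 < ((x : ℂ) + y * Complex.I).im := by simpa using hy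
  have hcont : Continuous fun x : ℝ => f (ofComplex (x + y * Complex.I)) := by
    simp only [fun x : ℝ => ofComplex_apply_of_im_pos (hpos x)]
    fun_prop
  have hper' : Periodic (fun x : ℝ => f (ofComplex (x + y * Complex.I))) 1 := fun x => by
    simpa [add_right_comm] using hper (x + y * Complex.I)
  have hbound (x : ℝ) : ‖f (ofComplex (x + y * Complex.I))‖ ≤ B :=
    hB _ (by simp [ofComplex_apply_of_im_pos (hpos x), ← coe_im])
  refine ⟨⟨hper'.lift, continuous_coinduced_dom.mpr hcont⟩, ?_, hper'.lift_coe⟩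
  refine (ContinuousMap.norm_le _ ((norm_nonneg _).trans (hbound 0))).mpr fun t => ?_
  induction t using QuotientAddGroup.induction_on with
  | H x => exact hbound x

lemma exists_lipschitzOnWith_rpow_mul_exp (s : ℝ) : ∃ K : NNReal, LipschitzOnWith K
    (fun u : ℝ => ((u ^ s * Real.exp (-(2 * Real.pi * u)) : ℝ) : ℂ)) (Set.Icc 1 2) := by
  refine ContDiffOn.exists_lipschitzOnWith (n := 1) (fun u hu => ?_) one_ne_zero
    (convex_Icc 1 2) isCompact_Icc
  have hu0 : u ≠ 0 := (zero_lt_one.trans_le hu.1).ne'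
  exact (Complex.ofRealCLM.contDiff.contDiffAt.comp u
    ((Real.contDiffAt_rpow_const_of_ne hu0).mul (by fun_prop))).contDiffWithinAt

section CuspForm

variable {Γ : Subgroup (GL (Fin 2) ℝ)} {k : ℤ}

lemma fourierCoeff_horocycle {𝓕 : Type*} [FunLike 𝓕 ℍ ℂ] [ModularFormClass 𝓕 Γ k] (f : 𝓕)
    (hΓ : (1 : ℝ) ∈ Γ.strictPeriods) {y : ℝ} (hy : 0 < y) {F : C(UnitAddCircle, ℂ)}
    (hF : ∀ x : ℝ, F x = f (ofComplex (x + y * Complex.I))) (n : ℕ) :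
    fourierCoeff F n = Real.exp (-(2 * Real.pi * (n * y))) * (qExpansion 1 f).coeff n := by
  have hpos (x : ℝ) : 0 < ((x : ℂ) + y * Complex.I).im := by simpa using hy
  have hchar (x : ℝ) : fourier (-n : ℤ) (x : UnitAddCircle) =
      Real.exp (-(2 * Real.pi * (n * y))) *
        (1 / Periodic.qParam 1 ((x : ℂ) + y * Complex.I) ^ n) := by
    rw [fourier_coe_apply, Periodic.qParam, one_div, ← Complex.exp_nat_mul, ← Complex.exp_neg,
      Complex.ofReal_exp, ← Complex.exp_add]
    congr 1
    push_cast
    linear_combination (2 * Real.pi * n * y : ℂ) * Complex.I_sq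
  rw [ModularFormClass.qExpansion_coeff_eq_intervalIntegral f one_pos hΓ n hy,
    fourierCoeff_eq_intervalIntegral _ _ 0]
  simp only [hF, hchar, ofComplex_apply_of_im_pos (hpos _), zero_add, div_one, one_smul,
    Complex.ofReal_one, one_mul, smul_eq_mul, mul_assoc, intervalIntegral.integral_const_mul]

lemma hasHorocycleModel_of_cuspForm [Γ.IsArithmetic]
    (f : CuspForm Γ k) (hΓ : (1 : ℝ) ∈ Γ.strictPeriods) {l : ℕ → ℂ}
    (hl : ∀ n : ℕ, 1 ≤ n →
      (qExpansion 1 f).coeff n = l n * (((n : ℝ) ^ (((k : ℝ) - 1) / 2) : ℝ) : ℂ)) :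
    HasHorocycleModel l := by
  obtain ⟨K, hK⟩ := exists_lipschitzOnWith_rpow_mul_exp (((k : ℝ) - 1) / 2)
  obtain ⟨B, hB⟩ := CuspFormClass.exists_bound f
  refine ⟨_, K, B, hK, fun u hu => ?_, fun y hy => ?_⟩
  · have : 0 < u := zero_lt_one.trans_le hu.1
    exact_mod_cast (by positivity : 0 < u ^ (((k : ℝ) - 1) / 2) * Real.exp (-(2 * Real.pi * u))).ne'
  have hf : Continuous f := (ModularFormClass.holo f).continuous
  have hyk : 0 < y ^ ((k : ℝ) / 2) := by positivity
  obtain ⟨F, hFB, hF⟩ := exists_continuousMap_horocycle hf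
    (by simpa using SlashInvariantFormClass.periodic_comp_ofComplex f hΓ) hy
    (B := B / y ^ ((k : ℝ) / 2)) fun z hz => hz ▸ hB z
  refine ⟨((y ^ ((k : ℝ) / 2) : ℝ) : ℂ) • F, ?_, fun n hn => ?_⟩
  · rw [norm_smul, Complex.norm_real, Real.norm_of_nonneg hyk.le]
    rwa [le_div_iff₀' hyk] at hFB
  have hn0 : (0 : ℝ) < n := by exact_mod_cast hn
  have hheight : y ^ ((k : ℝ) / 2) * (n : ℝ) ^ (((k : ℝ) - 1) / 2) =
      √y * (n * y) ^ (((k : ℝ) - 1) / 2) := by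
    rw [Real.mul_rpow hn0.le hy.le, Real.sqrt_eq_rpow, mul_left_comm, ← Real.rpow_add hy]
    ring_nf
  rw [ContinuousMap.coe_smul, fourierCoeff.const_smul, fourierCoeff_horocycle f hΓ hy hF, hl n hn,
    smul_eq_mul]
  have hheightC := congrArg ((↑) : ℝ → ℂ) hheight
  push_cast at hheightC ⊢
  linear_combination l n * Complex.exp (-(2 * Real.pi * (n * y))) * hheightC

end CuspForm

/-! ### The K-Bessel function -/

section Bessel

open Filter Topology

lemma one_add_sq_div_two_le_cosh (t : ℝ) : 1 + t ^ 2 / 2 ≤ Real.cosh t := by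
  have hsinh : (t / 2) ^ 2 ≤ Real.sinh (t / 2) ^ 2 := by
    rw [sq_le_sq, Real.abs_sinh]
    exact Real.self_le_sinh_iff.mpr (abs_nonneg _)
  have hcosh : Real.cosh t = Real.cosh (t / 2) ^ 2 + Real.sinh (t / 2) ^ 2 := by
    rw [← Real.cosh_two_mul, mul_div_cancel₀ t two_ne_zero]
  linarith [Real.cosh_sq (t / 2)]

lemma norm_cosh_le_exp_norm (z : ℂ) : ‖Complex.cosh z‖ ≤ Real.exp ‖z‖ := by
  rw [Complex.cosh, norm_div, Complex.norm_ofNat, div_le_iff₀ two_pos]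
  have hneg := Complex.norm_exp_le_exp_norm (-z)
  rw [norm_neg] at hneg
  linarith [norm_add_le (Complex.exp z) (Complex.exp (-z)), Complex.norm_exp_le_exp_norm z]

lemma norm_cosh_mul_ofReal_le (s : ℂ) {t : ℝ} (ht : 0 ≤ t) :
    ‖Complex.cosh (s * t)‖ ≤ Real.exp (‖s‖ * t) := by
  simpa [abs_of_nonneg ht] using norm_cosh_le_exp_norm (s * t)

lemma integrable_exp_neg_mul_sq_mul_exp {b : ℝ} (hb : 0 < b) (a : ℝ) :
    Integrable fun t : ℝ => Real.exp (-(b * t ^ 2)) * Real.exp (a * t) := by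
  have h := (integrable_cexp_quadratic (b := (b : ℂ)) (by simpa using hb) a 0).re
  refine h.congr (.of_forall fun t => ?_)
  beta_reduce
  rw [← Real.exp_add, RCLike.re_eq_complex_re, ← Complex.exp_ofReal_re]
  push_cast
  ring_nf

lemma integrable_exp_neg_mul_cosh_mul_exp {y : ℝ} (hy : 0 < y) (a : ℝ) :
    Integrable fun t : ℝ => Real.exp (-(y * Real.cosh t)) * Real.exp (a * t) := by
  refine (integrable_exp_neg_mul_sq_mul_exp (half_pos hy) a).mono'
    (Continuous.aestronglyMeasurable (by fun_prop)) (.of_forall fun t => ?_)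
  rw [Real.norm_of_nonneg (by positivity)]
  have hcosh : y / 2 * t ^ 2 ≤ y * Real.cosh t := by
    nlinarith [one_add_sq_div_two_le_cosh t]
  exact mul_le_mul_of_nonneg_right (Real.exp_le_exp.mpr (neg_le_neg hcosh)) (Real.exp_pos _).le

lemma norm_besselK_integrand_le (s : ℂ) (y : ℝ) {t : ℝ} (ht : 0 ≤ t) :
    ‖((Real.exp (-(y * Real.cosh t)) : ℝ) : ℂ) * Complex.cosh (s * (t : ℂ))‖ ≤
      Real.exp (-(y * Real.cosh t)) * Real.exp (‖s‖ * t) := by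
  rw [norm_mul, Complex.norm_real, Real.norm_of_nonneg (Real.exp_pos _).le]
  gcongr
  exact norm_cosh_mul_ofReal_le s ht

lemma integrableOn_besselK (s : ℂ) {y : ℝ} (hy : 0 < y) :
    IntegrableOn (fun t : ℝ => ((Real.exp (-(y * Real.cosh t)) : ℝ) : ℂ) *
      Complex.cosh (s * (t : ℂ))) (Set.Ioi 0) := by
  refine (integrable_exp_neg_mul_cosh_mul_exp hy ‖s‖).integrableOn.mono'
    (Continuous.aestronglyMeasurable (by fun_prop)) ?_
  filter_upwards [ae_restrict_mem measurableSet_Ioi] with t ht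
  exact norm_besselK_integrand_le s y (Set.mem_Ioi.mp ht).le

lemma abs_exp_neg_sub_exp_neg_le {p q r : ℝ} (hp : r ≤ p) (hq : r ≤ q) :
    |Real.exp (-p) - Real.exp (-q)| ≤ Real.exp (-r) * |p - q| := by
  have hderiv (x : ℝ) (_ : x ∈ Set.Ici r) :
      HasDerivWithinAt (fun x => Real.exp (-x)) (-Real.exp (-x)) (Set.Ici r) x := by
    simpa using (hasDerivAt_neg x).exp.hasDerivWithinAt
  refine (convex_Ici r).norm_image_sub_le_of_norm_hasDerivWithin_le hderiv (fun x hx => ?_) hq hp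
  rw [norm_neg, Real.norm_of_nonneg (Real.exp_pos _).le]
  gcongr
  exact hx

lemma exists_lipschitzOnWith_besselK (s : ℂ) {A : ℝ} (hA : 0 < A) :
    ∃ K : NNReal, LipschitzOnWith K (besselK s) (Set.Ici A) := by
  have hint := (integrable_exp_neg_mul_cosh_mul_exp hA (‖s‖ + 1)).integrableOn (s := Set.Ioi 0)
  refine ⟨Real.toNNReal _, LipschitzOnWith.of_dist_le' (K := ∫ t in Set.Ioi (0 : ℝ),
    Real.exp (-(A * Real.cosh t)) * Real.exp ((‖s‖ + 1) * t)) fun u hu v hv => ?_⟩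
  rw [Set.mem_Ici] at hu hv
  rw [dist_eq_norm, besselK, besselK, ← integral_sub (integrableOn_besselK s (hA.trans_le hu))
    (integrableOn_besselK s (hA.trans_le hv)), ← integral_mul_const]
  refine norm_integral_le_of_norm_le (hint.mul_const _) ?_
  filter_upwards [ae_restrict_mem measurableSet_Ioi] with t ht
  have ht : 0 < t := ht
  have hcosh : |u * Real.cosh t - v * Real.cosh t| ≤ Real.exp t * dist u v := by
    rw [← sub_mul, abs_mul, abs_of_pos (Real.cosh_pos t), mul_comm, Real.dist_eq]
    gcongr
    rw [Real.cosh_eq]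
    linarith [Real.exp_le_exp.mpr (by linarith : -t ≤ t)]
  rw [← sub_mul, ← Complex.ofReal_sub, norm_mul, Complex.norm_real, Real.norm_eq_abs]
  calc _ ≤ Real.exp (-(A * Real.cosh t)) * (Real.exp t * dist u v) * Real.exp (‖s‖ * t) := by
        gcongr
        · exact (abs_exp_neg_sub_exp_neg_le (r := A * Real.cosh t) (by gcongr) (by gcongr)).trans
            (by gcongr)
        · exact norm_cosh_mul_ofReal_le s ht.le
    _ = _ := by rw [add_mul, one_mul, Real.exp_add]; ring

lemma sqrt_mul_exp_mul_besselK (s : ℂ) {y : ℝ} (hy : 0 < y) :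
    ((√y * Real.exp y : ℝ) : ℂ) * besselK s y = ∫ x in Set.Ioi (0 : ℝ),
      ((Real.exp (-(y * (Real.cosh ((√y)⁻¹ * x) - 1))) : ℝ) : ℂ) *
        Complex.cosh (s * (((√y)⁻¹ * x : ℝ) : ℂ)) := by
  have hsub := integral_comp_mul_left_Ioi (fun t : ℝ =>
    ((Real.exp (-(y * (Real.cosh t - 1))) : ℝ) : ℂ) * Complex.cosh (s * (t : ℂ))) 0
    (inv_pos.mpr (Real.sqrt_pos.mpr hy))
  rw [hsub, inv_inv, mul_zero, besselK, Complex.ofReal_mul, mul_assoc, ← integral_const_mul,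
    Complex.real_smul]
  congr! 3 with _
  rw [← mul_assoc, ← Complex.ofReal_mul, ← Real.exp_add]
  ring_nf

lemma norm_exp_mul_cosh_rescaled_le (s : ℂ) {y x : ℝ} (hy : 1 ≤ y) (hx : 0 ≤ x) :
    ‖((Real.exp (-(y * (Real.cosh ((√y)⁻¹ * x) - 1))) : ℝ) : ℂ) *
        Complex.cosh (s * (((√y)⁻¹ * x : ℝ) : ℂ))‖ ≤
      Real.exp (-(1 / 2 * x ^ 2)) * Real.exp (‖s‖ * x) := by
  have hy0 : 0 < y := one_pos.trans_le hy
  have hexp : 1 / 2 * x ^ 2 ≤ y * (Real.cosh ((√y)⁻¹ * x) - 1) := by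
    calc 1 / 2 * x ^ 2 = y * (((√y)⁻¹ * x) ^ 2 / 2) := by
          rw [mul_pow, inv_pow, Real.sq_sqrt hy0.le]; field_simp
      _ ≤ _ := by gcongr; linarith [one_add_sq_div_two_le_cosh ((√y)⁻¹ * x)]
  have hle : (√y)⁻¹ * x ≤ x :=
    mul_le_of_le_one_left hx (inv_le_one_of_one_le₀ (Real.one_le_sqrt.mpr hy))
  rw [norm_mul, Complex.norm_real, Real.norm_of_nonneg (Real.exp_pos _).le]
  refine mul_le_mul (Real.exp_le_exp.mpr (neg_le_neg hexp)) ?_ (norm_nonneg _) (Real.exp_pos _).le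
  exact (norm_cosh_mul_ofReal_le s (by positivity)).trans (by gcongr)

lemma tendsto_mul_cosh_inv_sqrt_mul_sub_one (x : ℝ) :
    Tendsto (fun y : ℝ => y * (Real.cosh ((√y)⁻¹ * x) - 1)) atTop (𝓝 (x ^ 2 / 2)) := by
  have hderiv : HasDerivAt (fun h : ℝ => Real.sinh (h * (x / 2))) (x / 2) 0 := by
    simpa using ((hasDerivAt_id (0 : ℝ)).mul_const (x / 2)).sinh
  have hsqrt : Tendsto (fun y : ℝ => (√y)⁻¹) atTop (𝓝[>] 0) :=
    tendsto_inv_atTop_nhdsGT_zero.comp Real.tendsto_sqrt_atTop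
  have hlim := (((hderiv.tendsto_slope_zero_right.comp hsqrt).pow 2).const_mul 2)
  rw [show 2 * (x / 2) ^ 2 = x ^ 2 / 2 by ring] at hlim
  refine hlim.congr' ?_
  filter_upwards [eventually_gt_atTop 0] with y hy
  have hcosh : Real.cosh ((√y)⁻¹ * x) - 1 = 2 * Real.sinh ((√y)⁻¹ * (x / 2)) ^ 2 := by
    rw [show (√y)⁻¹ * x = 2 * ((√y)⁻¹ * (x / 2)) by ring, Real.cosh_two_mul, Real.cosh_sq]
    ring
  simp only [comp_apply, zero_add, zero_mul, Real.sinh_zero, sub_zero, inv_inv, smul_eq_mul,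
    mul_pow, Real.sq_sqrt hy.le, hcosh]
  ring

lemma tendsto_sqrt_mul_exp_mul_besselK (s : ℂ) :
    Tendsto (fun y : ℝ => ((√y * Real.exp y : ℝ) : ℂ) * besselK s y) atTop
      (𝓝 (√(Real.pi / 2) : ℝ)) := by
  have hgauss : ((√(Real.pi / 2) : ℝ) : ℂ) =
      ∫ x in Set.Ioi (0 : ℝ), ((Real.exp (-(x ^ 2 / 2)) : ℝ) : ℂ) := by
    have hpi : √(Real.pi / 2) = √(Real.pi / (1 / 2)) / 2 := by
      rw [eq_div_iff two_ne_zero, show Real.pi / (1 / 2) = Real.pi / 2 * 2 ^ 2 by ring,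
        Real.sqrt_mul' _ (by positivity), Real.sqrt_sq two_pos.le]
    rw [integral_complex_ofReal, hpi, ← integral_gaussian_Ioi]
    congr! 4 with x
    ring
  rw [hgauss]
  refine (tendsto_integral_filter_of_dominated_convergence
    (F := fun y x => ((Real.exp (-(y * (Real.cosh ((√y)⁻¹ * x) - 1))) : ℝ) : ℂ) *
      Complex.cosh (s * (((√y)⁻¹ * x : ℝ) : ℂ)))
    (fun x => Real.exp (-(1 / 2 * x ^ 2)) * Real.exp (‖s‖ * x))
    (.of_forall fun y => Continuous.aestronglyMeasurable (by fun_prop)) ?_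
    (integrable_exp_neg_mul_sq_mul_exp one_half_pos _).integrableOn ?_).congr' ?_
  · filter_upwards [eventually_ge_atTop 1] with y hy
    filter_upwards [ae_restrict_mem measurableSet_Ioi] with x hx
    exact norm_exp_mul_cosh_rescaled_le s hy (Set.mem_Ioi.mp hx).le
  · refine .of_forall fun x => ?_
    have hcosh : Tendsto (fun y : ℝ => Complex.cosh (s * (((√y)⁻¹ * x : ℝ) : ℂ))) atTop (𝓝 1) := by
      have hzero : Tendsto (fun y : ℝ => (√y)⁻¹ * x) atTop (𝓝 0) := by
        simpa using (tendsto_inv_atTop_zero.comp Real.tendsto_sqrt_atTop).mul_const x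
      have hcont : Continuous fun t : ℝ => Complex.cosh (s * (t : ℂ)) := by fun_prop
      simpa [comp_def] using (hcont.tendsto 0).comp hzero
    have hexp := (Real.continuous_exp.tendsto _).comp (tendsto_mul_cosh_inv_sqrt_mul_sub_one x).neg
    simpa using ((Complex.continuous_ofReal.tendsto _).comp hexp).mul hcosh
  · filter_upwards [eventually_gt_atTop 0] with y hy
    exact (sqrt_mul_exp_mul_besselK s hy).symm

lemma exists_besselK_ne_zero_and_norm_le (s : ℂ) :
    ∃ u₀ : ℝ, 1 ≤ u₀ ∧ (∀ u, u₀ ≤ u → besselK s u ≠ 0) ∧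
      ∀ u v, u₀ ≤ u → u ≤ v → √v * ‖besselK s v‖ ≤ 4 * (√u * ‖besselK s u‖) := by
  set L : ℝ := √(Real.pi / 2)
  have hL : 0 < L := Real.sqrt_pos.mpr (by positivity)
  have hlim : Tendsto (fun y : ℝ => √y * Real.exp y * ‖besselK s y‖) atTop (𝓝 L) := by
    have h := (tendsto_sqrt_mul_exp_mul_besselK s).norm
    rw [Complex.norm_real, Real.norm_of_nonneg hL.le] at h
    refine h.congr fun y => ?_
    rw [norm_mul, Complex.norm_real, Real.norm_of_nonneg (by positivity)]
  obtain ⟨u₀, hu₀⟩ := eventually_atTop.mp (hlim.eventually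
    (Ioo_mem_nhds (half_lt_self hL) (lt_two_mul_self hL)))
  refine ⟨max u₀ 1, le_max_right _ _, fun u hu hzero => ?_, fun u v hu huv => ?_⟩
  · have hpos := (hu₀ u ((le_max_left _ _).trans hu)).1
    rw [hzero, norm_zero, mul_zero] at hpos
    exact hpos.not_gt (half_pos hL)
  · have hlow := (hu₀ u ((le_max_left _ _).trans hu)).1
    have hupp := (hu₀ v ((le_max_left _ _).trans (hu.trans huv))).2
    refine le_of_mul_le_mul_right ?_ (Real.exp_pos v)
    calc √v * ‖besselK s v‖ * Real.exp v = √v * Real.exp v * ‖besselK s v‖ := by ring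
      _ ≤ 4 * (√u * Real.exp u * ‖besselK s u‖) := by linarith
      _ ≤ 4 * (√u * Real.exp v * ‖besselK s u‖) := by gcongr
      _ = 4 * (√u * ‖besselK s u‖) * Real.exp v := by ring

end Bessel

/-! ### Maass cusp forms -/

lemma fourierCoeff_of_hasSum {ι : Type*} {e : ι → ℤ} (he : Function.Injective e) {a : ι → ℂ}
    {F : UnitAddCircle → ℂ} (hF : ∀ t, HasSum (fun i => a i * fourier (e i) t) (F t)) (i : ι) :
    fourierCoeff F (e i) = a i := by
  classical
  have hcount : Countable ι := he.countable
  have hsum : Summable fun j => ‖a j‖ := by simpa [fourier_eval_zero] using (hF 0).summable.norm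
  have hint (j : ι) : Integrable (fun t : UnitAddCircle =>
      fourier (-e i) t • (a j • (fourier (e j) : UnitAddCircle → ℂ)) t) haarAddCircle :=
    integrable_of_continuous
      ((map_continuous (fourier (-e i))).smul ((map_continuous (fourier (e j))).const_smul (a j)))
  have hcoeff := hasSum_integral_of_summable_integral_norm hint (by
    simpa [norm_smul, fourier_apply, Circle.norm_coe] using hsum)
  have hterm (j : ι) : ∫ t : UnitAddCircle, fourier (-e i) t •
      (a j • (fourier (e j) : UnitAddCircle → ℂ)) t ∂haarAddCircle = if j = i then a i else 0 := by
    rw [← fourierCoeff, fourierCoeff.const_smul, fourierCoeff_fourier, Pi.single_apply]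
    by_cases hji : j = i <;> simp [hji, he.eq_iff, eq_comm (a := i)]
  have htsum (t : UnitAddCircle) : ∑' j, fourier (-e i) t •
      (a j • (fourier (e j) : UnitAddCircle → ℂ)) t = fourier (-e i) t • F t :=
    ((hF t).mul_left _).tsum_eq
  simp_rw [hterm, htsum] at hcoeff
  exact hcoeff.unique (hasSum_ite_eq i (a i))

section Maass

/-- The Fourier coefficient `√y c(n) K_s(2π|n|y)` of index `n`, on the horocycle of height `y`, of a
Maass form with Fourier-Bessel coefficients `c`. -/
def besselCoeff (s : ℂ) (c : ℤ → ℂ) (y : ℝ) (n : ℤ) : ℂ :=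
  (√y : ℂ) * c n * besselK s (2 * Real.pi * |(n : ℝ)| * y)

lemma norm_besselCoeff_le {s : ℂ} {u₀ M : ℝ}
    (hK : ∀ u v, u₀ ≤ u → u ≤ v → √v * ‖besselK s v‖ ≤ M * (√u * ‖besselK s u‖))
    (hu₀ : 0 ≤ u₀) (c : ℤ → ℂ) {n : ℤ} (hn : n ≠ 0) {y : ℝ} (hy : u₀ ≤ y) :
    ‖besselCoeff s c y n‖ ≤ M * ‖besselCoeff s c u₀ n‖ := by
  set r : ℝ := 2 * Real.pi * |(n : ℝ)|
  have hr : 1 ≤ r := by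
    have habs : (1 : ℝ) ≤ |(n : ℝ)| := by exact_mod_cast Int.one_le_abs hn
    nlinarith [Real.pi_gt_three]
  have hr0 : 0 < √r := Real.sqrt_pos.mpr (one_pos.trans_le hr)
  have h := hK (r * u₀) (r * y) (le_mul_of_one_le_left hu₀ hr) (by gcongr)
  rw [Real.sqrt_mul' r hu₀, Real.sqrt_mul' r (hu₀.trans hy)] at h
  have h' : √y * ‖besselK s (r * y)‖ ≤ M * (√u₀ * ‖besselK s (r * u₀)‖) :=
    le_of_mul_le_mul_left (by linarith) hr0
  simp only [besselCoeff, norm_mul, Complex.norm_real, Real.norm_of_nonneg (Real.sqrt_nonneg _)]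
  linarith [mul_le_mul_of_nonneg_left h' (norm_nonneg (c n))]

variable {s : ℂ} {f : ℍ → ℂ} {c : ℤ → ℂ}

lemma isBoundedAtImInfty_of_hasSum_besselCoeff (hf : ∀ z : ℍ, HasSum (fun n : {n : ℤ // n ≠ 0} =>
      besselCoeff s c z.im n * fourier (n : ℤ) (z.re : UnitAddCircle)) (f z)) :
    IsBoundedAtImInfty f := by
  obtain ⟨u₀, hu₀, -, hK⟩ := exists_besselK_ne_zero_and_norm_le s
  have hsum := (hf ⟨u₀ * Complex.I, by simpa using one_pos.trans_le hu₀⟩).summable.norm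
  simp only [norm_mul, fourier_apply, Circle.norm_coe, mul_one, mk_im, Complex.mul_I_im,
    Complex.ofReal_re] at hsum
  refine isBoundedAtImInfty_iff.mpr
    ⟨∑' n : {n : ℤ // n ≠ 0}, 4 * ‖besselCoeff s c u₀ n‖, u₀, fun z hz => ?_⟩
  rw [← (hf z).tsum_eq]
  refine tsum_of_norm_bounded (hsum.mul_left 4).hasSum fun n => ?_
  rw [norm_mul, fourier_apply, Circle.norm_coe, mul_one]
  exact norm_besselCoeff_le hK (zero_le_one.trans hu₀) c n.2 hz

lemma hasHorocycleModel_of_hasSum_besselCoeff {l : ℕ → ℂ} {B : ℝ} (hf : Continuous f)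
    (hper : Periodic (f ∘ ofComplex) 1) (hB : ∀ z, ‖f z‖ ≤ B)
    (hexp : ∀ z : ℍ, HasSum (fun n : {n : ℤ // n ≠ 0} =>
      besselCoeff s c z.im n * fourier (n : ℤ) (z.re : UnitAddCircle)) (f z))
    (hl : ∀ n : ℕ, 1 ≤ n → l n = c n) : HasHorocycleModel l := by
  -- At height `A y` every Bessel function is evaluated beyond `A`, where it has no zeros.
  obtain ⟨A, hA, hne, -⟩ := exists_besselK_ne_zero_and_norm_le s
  have hA0 : 0 < A := one_pos.trans_le hA
  obtain ⟨K, hK⟩ := exists_lipschitzOnWith_besselK s hA0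
  have hscale : ∀ u ∈ Set.Icc (1 : ℝ) 2, A ≤ 2 * Real.pi * A * u := fun u hu => by
    nlinarith [Real.pi_gt_three, hu.1, mul_le_mul_of_nonneg_left hu.1 hA0.le]
  have hlip := (lipschitzWith_smul (2 * Real.pi * A)).lipschitzOnWith (s := Set.Icc (1 : ℝ) 2)
  refine ⟨fun u => √A * besselK s (2 * Real.pi * A * u), _, B,
    (lipschitzWith_smul (√A : ℂ)).comp_lipschitzOnWith (hK.comp hlip hscale),
    fun u hu => mul_ne_zero (by exact_mod_cast (Real.sqrt_pos.mpr hA0).ne') (hne _ (hscale u hu)),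
    fun y hy => ?_⟩
  have hAy : 0 < A * y := by positivity
  obtain ⟨F, hFB, hF⟩ := exists_continuousMap_horocycle hf hper hAy fun z _ => hB z
  refine ⟨F, hFB, fun n hn => ?_⟩
  have hsum (t : UnitAddCircle) : HasSum (fun n : {n : ℤ // n ≠ 0} =>
      besselCoeff s c (A * y) n * fourier (n : ℤ) t) (F t) := by
    induction t using QuotientAddGroup.induction_on with
    | H x =>
      have hpos : 0 < ((x : ℂ) + (A * y : ℝ) * Complex.I).im := by simpa using hAy
      have h := hexp ⟨_, hpos⟩
      rw [hF, ofComplex_apply_of_im_pos hpos]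
      simpa using h
  rw [fourierCoeff_of_hasSum Subtype.val_injective hsum ⟨n, by exact_mod_cast (by omega : n ≠ 0)⟩,
    besselCoeff, Real.sqrt_mul hA0.le, hl n hn]
  simp only [Int.cast_natCast, Nat.abs_cast, Complex.ofReal_mul]
  ring_nf

namespace IsMaassCuspForm

variable {ν : ℂ}

lemma continuous (hf : IsMaassCuspForm ν f) : Continuous f := by
  have h : Continuous fun z : ℍ => f (ofComplex z) :=
    hf.smooth.continuousOn.comp_continuous UpperHalfPlane.continuous_coe fun z => z.im_pos
  simpa using h

lemma periodic_comp_ofComplex (hf : IsMaassCuspForm ν f) : Periodic (f ∘ ofComplex) 1 := by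
  intro w
  rcases lt_or_ge 0 w.im with hw | hw
  · have hw' : 0 < (w + 1).im := by simpa using hw
    rw [comp_apply, comp_apply, ofComplex_apply_of_im_pos hw, ofComplex_apply_of_im_pos hw',
      ← hf.invariant ModularGroup.T ⟨w, hw⟩, modular_T_smul]
    congr 1
    ext
    simp [add_comm]
  · have hw' : (w + 1).im ≤ 0 := by simpa using hw
    rw [comp_apply, comp_apply, ofComplex_apply_eq_of_im_nonpos hw' hw]

end IsMaassCuspForm

lemma IsMaassHeckeCoeff.hasHorocycleModel {l : ℕ → ℂ} (h : IsMaassHeckeCoeff l) :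
    HasHorocycleModel l := by
  obtain ⟨ν, f, c, hf, -, hexp, -, hl⟩ := h
  have hexp' (z : ℍ) : HasSum (fun n : {n : ℤ // n ≠ 0} =>
      besselCoeff (Complex.I * ν) c z.im n * fourier (n : ℤ) (z.re : UnitAddCircle)) (f z) := by
    simpa [besselCoeff, fourier_coe_apply] using hexp z
  obtain ⟨B, hB⟩ := ModularGroup.exists_bound_of_invariant hf.continuous
    (isBoundedAtImInfty_of_hasSum_besselCoeff hexp') hf.invariant
  exact hasHorocycleModel_of_hasSum_besselCoeff hf.continuous hf.periodic_comp_ofComplex hB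
    hexp' hl

end Maass

lemma IsHolomorphicHeckeCoeff.hasHorocycleModel {l : ℕ → ℂ} (h : IsHolomorphicHeckeCoeff l) :
    HasHorocycleModel l :=
  let ⟨_, f, _, hl, _⟩ := h
  hasHorocycleModel_of_cuspForm f one_mem_strictPeriods_SL hl

lemma IsHeckeCoeff.hasHorocycleModel {l : ℕ → ℂ} (h : IsHeckeCoeff l) : HasHorocycleModel l :=
  h.elim IsHolomorphicHeckeCoeff.hasHorocycleModel IsMaassHeckeCoeff.hasHorocycleModel

end DoubleShift

end

open DoubleShift in
theorem theorem1p1_general {l₁ l₂ l₃ : ℕ → ℂ} (h₁ : HasHorocycleModel l₁)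
    (h₂ : HasHorocycleModel l₂) (h₃ : HasHorocycleModel l₃) {V W : ℝ → ℝ}
    (hV : IsLipschitzBump V) (hW : IsLipschitzBump W) :
    (∀ ε c : ℝ, 0 < c → ∃ C : ℝ, ∀ N H : ℝ, 1 ≤ N → c * N ^ (1 / 2 + ε) ≤ H →
      ‖doubleShiftSum l₁ l₂ l₃ V W N H‖ ≤ C * N ^ (1 - min ε (1 / 2))) ∧
    (∀ ε : ℝ, 0 ≤ ε → ∃ C : ℝ, ∀ N H : ℝ, 1 ≤ N → 0 < H →
      ‖doubleShiftSum l₁ l₂ l₃ V W N H‖ ≤ C * (N ^ (3 / 2 + ε) / H + N ^ (1 / 2 + ε))) := by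
  obtain ⟨C, hC0, hC⟩ := exists_norm_doubleShiftSum_le h₁ h₂ h₃ hV hW
  constructor
  · refine fun ε c hc => ⟨C * (c⁻¹ + 1), fun N H hN hH => ?_⟩
    have hN0 : 0 < N := by linarith
    have hH0 : 0 < H := lt_of_lt_of_le (by positivity) hH
    rw [mul_assoc]
    refine (hC N H hN hH0).trans (mul_le_mul_of_nonneg_left ?_ hC0)
    calc N ^ (3 / 2 : ℝ) / H + N ^ (1 / 2 : ℝ)
        ≤ N ^ (3 / 2 : ℝ) / (c * N ^ (1 / 2 + ε)) + N ^ (1 / 2 : ℝ) := by gcongr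
      _ = c⁻¹ * N ^ (1 - ε) + N ^ (1 / 2 : ℝ) := by
          rw [div_mul_eq_div_div_swap, ← Real.rpow_sub hN0]; ring_nf
      _ ≤ c⁻¹ * N ^ (1 - min ε (1 / 2)) + N ^ (1 - min ε (1 / 2)) := by
          gcongr <;> linarith [min_le_left ε (1 / 2), min_le_right ε (1 / 2)]
      _ = _ := by ring
  · refine fun ε hε => ⟨C, fun N H hN hH => (hC N H hN hH).trans ?_⟩
    gcongr <;> linarith

theorem theorem1p1 :
    (∀ ε : ℝ, 0 < ε → ∃ δ : ℝ, 0 < δ ∧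
      ∀ l₁ l₂ l₃ : ℕ → ℂ, DoubleShift.IsHeckeCoeff l₁ → DoubleShift.IsHeckeCoeff l₂ →
        DoubleShift.IsHeckeCoeff l₃ →
      ∀ V W : ℝ → ℝ, DoubleShift.IsBump V → DoubleShift.IsBump W →
      ∀ c : ℝ, 0 < c → ∃ C : ℝ, ∀ N H : ℝ, 1 ≤ N → c * N ^ (1 / 2 + ε) ≤ H →
        ‖DoubleShift.doubleShiftSum l₁ l₂ l₃ V W N H‖ ≤ C * N ^ (1 - δ)) ∧
    (∀ l₁ l₂ l₃ : ℕ → ℂ, DoubleShift.IsHeckeCoeff l₁ → DoubleShift.IsHeckeCoeff l₂ →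
        DoubleShift.IsHeckeCoeff l₃ →
      ∀ V W : ℝ → ℝ, DoubleShift.IsBump V → DoubleShift.IsBump W →
      ∀ ε : ℝ, 0 < ε → ∃ C : ℝ, ∀ N H : ℝ, 1 ≤ N → 0 < H →
        ‖DoubleShift.doubleShiftSum l₁ l₂ l₃ V W N H‖ ≤
          C * (N ^ (3 / 2 + ε) / H + N ^ (1 / 2 + ε))) :=
  ⟨fun ε hε => ⟨min ε (1 / 2), by positivity, fun _ _ _ h₁ h₂ h₃ _ _ hV hW =>
    (theorem1p1_general h₁.hasHorocycleModel h₂.hasHorocycleModel h₃.hasHorocycleModel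
      hV.isLipschitzBump hW.isLipschitzBump).1 ε⟩,
  fun _ _ _ h₁ h₂ h₃ _ _ hV hW ε hε =>
    (theorem1p1_general h₁.hasHorocycleModel h₂.hasHorocycleModel h₃.hasHorocycleModel
      hV.isLipschitzBump hW.isLipschitzBump).2 ε hε.le⟩
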